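/- Let $X$ be a zero-dimensional Hausdorff space, that is, a Hausdorff space whose clopen subsets form a base of its topology. Let $C_c(X)$ be the ring of all continuous functions $f : X \to \mathbb{R}$ whose range $f(X)$ is countable, with pointwise operations. The $m_c$-topology on $C_c(X)$ is the topology with base the sets $$M(g,u) = \{f \in C_c(X) : |f(x) - g(x)| < u(x) \text{ for every } x \in X\},$$ where $g \in C_c(X)$ and $u$ is a positive unit of $C_c(X)$, i.e. a unit $u$ of this ring with $u(x) > 0$ for all $x \in X$. Then for every ideal $I$ of $C_c(X)$ (possibly $I = C_c(X)$, where the intersection of the empty family of ideals is $C_c(X)$): 1. the closure of $I$ in the $m_c$-topology equals the intersection of all maximal ideals of $C_c(X)$ that contain $I$; 2. $I$ is closed in the $m_c$-topology if and only if $I$ is the intersection of all maximal ideals of $C_c(X)$ that contain it; 3. $I$ is closed in the $m_c$-topology if and only if $I$ is the intersection of some family of maximal ideals of $C_c(X)$. -/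

import Mathlib

open Topology

/-- Any pointwise combination of two functions with countable range has countable range. -/
theorem countable_range_of_comp₂ {X : Type*} {f g : X → ℝ} (hf : (Set.range f).Countable)
    (hg : (Set.range g).Countable) (F : ℝ → ℝ → ℝ) :
    (Set.range fun x => F (f x) (g x)).Countable := by
  refine (hf.image2 hg F).mono ?_
  rintro _ ⟨x, rfl⟩
  exact ⟨f x, ⟨x, rfl⟩, g x, ⟨x, rfl⟩, rfl⟩

/-- `C_c(X)`: the ring of continuous functions `X → ℝ` with countable range. -/
def Cc (X : Type*) [TopologicalSpace X] : Subalgebra ℝ C(X, ℝ) where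
  carrier := {f | (Set.range f).Countable}
  mul_mem' := fun hf hg => countable_range_of_comp₂ hf hg (fun a b => a * b)
  add_mem' := fun hf hg => countable_range_of_comp₂ hf hg (fun a b => a + b)
  algebraMap_mem' := fun r => (Set.countable_singleton r).mono (by rintro _ ⟨x, rfl⟩; rfl)

/-- A positive unit of `C_c(X)`: a unit of the ring all of whose values are positive. -/
def Cc.IsPosUnit {X : Type*} [TopologicalSpace X] (u : Cc X) : Prop :=
  IsUnit u ∧ ∀ x : X, 0 < (u : C(X, ℝ)) x

/-- `M(g, u) = {f ∈ C_c(X) : |f(x) - g(x)| < u(x) for each x ∈ X}`. -/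
def Cc.M {X : Type*} [TopologicalSpace X] (g u : Cc X) : Set (Cc X) :=
  {f | ∀ x : X, |(f : C(X, ℝ)) x - (g : C(X, ℝ)) x| < (u : C(X, ℝ)) x}

/-- The `m_c`-topology on `C_c(X)`: it is generated by the sets `M(g, u)`, where `g ∈ C_c(X)` and
`u` is a positive unit of `C_c(X)`. These sets form a base of it, see `Cc.isTopologicalBasis_mc`.
It is not an instance: `C_c(X)` already carries the compact-open topology of `C(X, ℝ)`. -/
@[reducible] def Cc.mcTopology (X : Type*) [TopologicalSpace X] : TopologicalSpace (Cc X) :=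
  TopologicalSpace.generateFrom {s | ∃ g u : Cc X, Cc.IsPosUnit u ∧ s = Cc.M g u}

/-- An element of `C_c(X)` with positive values is a positive unit. -/
theorem Cc.isPosUnit_of_pos {X : Type*} [TopologicalSpace X] (u : Cc X)
    (hu : ∀ x : X, 0 < (u : C(X, ℝ)) x) : Cc.IsPosUnit u := by
  refine ⟨?_, hu⟩
  let v : C(X, ℝ) := ⟨fun x => ((u : C(X, ℝ)) x)⁻¹,
    (u : C(X, ℝ)).continuous.inv₀ fun x => (hu x).ne'⟩
  have hv : v ∈ Cc X := countable_range_of_comp₂ u.2 u.2 (fun a _ => a⁻¹)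
  refine IsUnit.of_mul_eq_one (⟨v, hv⟩ : Cc X) ?_
  ext x
  exact mul_inv_cancel₀ (hu x).ne'

/-- The sets `M(g, u)` form a base of the `m_c`-topology. -/
theorem Cc.isTopologicalBasis_mc (X : Type*) [TopologicalSpace X] :
    @TopologicalSpace.IsTopologicalBasis (Cc X) (Cc.mcTopology X)
      {s | ∃ g u : Cc X, Cc.IsPosUnit u ∧ s = Cc.M g u} := by
  let _ := Cc.mcTopology X
  refine ⟨?_, ?_, rfl⟩
  · rintro _ ⟨g₁, u₁, -, rfl⟩ _ ⟨g₂, u₂, -, rfl⟩ f ⟨h₁, h₂⟩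
    let w (g u : Cc X) : Cc X := ⟨(u : C(X, ℝ)) - |(f : C(X, ℝ)) - (g : C(X, ℝ))|,
      countable_range_of_comp₂ u.2
        (countable_range_of_comp₂ f.2 g.2 fun a b => |a - b|) fun a b => a - b⟩
    let v : Cc X := ⟨(w g₁ u₁ : C(X, ℝ)) ⊓ (w g₂ u₂ : C(X, ℝ)),
      countable_range_of_comp₂ (w g₁ u₁).2 (w g₂ u₂).2 fun a b => a ⊓ b⟩
    have hv (x : X) : (v : C(X, ℝ)) x =
        min ((u₁ : C(X, ℝ)) x - |(f : C(X, ℝ)) x - (g₁ : C(X, ℝ)) x|)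
          ((u₂ : C(X, ℝ)) x - |(f : C(X, ℝ)) x - (g₂ : C(X, ℝ)) x|) := rfl
    have hp : Cc.IsPosUnit v := Cc.isPosUnit_of_pos v fun x => by
      rw [hv]; exact lt_min (sub_pos.2 (h₁ x)) (sub_pos.2 (h₂ x))
    refine ⟨_, ⟨f, v, hp, rfl⟩, fun x => by simpa using hp.2 x, fun k hk => ⟨fun x => ?_, fun x => ?_⟩⟩
    all_goals
      have h := hk x
      rw [hv, lt_min_iff] at h
    · exact (abs_sub_le _ ((f : C(X, ℝ)) x) _).trans_lt (by linarith [h.1])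
    · exact (abs_sub_le _ ((f : C(X, ℝ)) x) _).trans_lt (by linarith [h.2])
  · refine Set.eq_univ_of_forall fun f => ⟨_, ⟨f, 1, ?_, rfl⟩, fun x => by simp⟩
    exact Cc.isPosUnit_of_pos 1 fun x => by simp

/-! The `m_c`-closure of `I` is its Jacobson radical; all three claims follow from this and the
closedness of maximal ideals. A maximal ideal `J` is closed: if `a * f + m = 1` with `m ∈ J`, any `g
∈ J` close enough to `f` makes `a * g + m` a unit in `J`. Conversely, `f` in the radical is
approximated within `u` by `f * e`, where `e` is the indicator of a clopen set `{r * u < |f|}`.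
There `f` is invertible, so `e` is a multiple of `f` and lies in the radical; being idempotent, it
lies in `I`. -/

namespace Cc

variable {X : Type*} [TopologicalSpace X]

/-- `C_c(X)` is closed under composition with a continuous function of two variables. -/
def comp₂ (F : ℝ → ℝ → ℝ) (hF : Continuous fun p : ℝ × ℝ => F p.1 p.2) (f g : Cc X) : Cc X :=
  ⟨⟨fun x => F ((f : C(X, ℝ)) x) ((g : C(X, ℝ)) x),
    hF.comp ((f : C(X, ℝ)).continuous.prodMk (g : C(X, ℝ)).continuous)⟩,
    countable_range_of_comp₂ f.2 g.2 F⟩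

/-- Membership in an `m_c`-closure is tested on the sets `M(f, u)` centred at the point. -/
theorem mem_closure_mc_iff {S : Set (Cc X)} {f : Cc X} :
    f ∈ closure[mcTopology X] S ↔ ∀ u : Cc X, IsPosUnit u → ∃ g ∈ S, g ∈ M f u := by
  let _ := mcTopology X
  rw [(isTopologicalBasis_mc X).mem_closure_iff]
  constructor
  · intro h u hu
    obtain ⟨g, hg, hgS⟩ := h _ ⟨f, u, hu, rfl⟩ fun x => by simpa using hu.2 x
    exact ⟨g, hgS, hg⟩
  · rintro h _ ⟨g₀, u₀, -, rfl⟩ hf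
    let d : Cc X := comp₂ (fun a b => |a - b|) (by fun_prop) f g₀
    have hd (x : X) : ((u₀ - d : Cc X) : C(X, ℝ)) x =
        (u₀ : C(X, ℝ)) x - |(f : C(X, ℝ)) x - (g₀ : C(X, ℝ)) x| := rfl
    obtain ⟨g, hgS, hg⟩ := h (u₀ - d) (isPosUnit_of_pos _ fun x => by
      rw [hd]; exact sub_pos.2 (hf x))
    refine ⟨g, fun x => ?_, hgS⟩
    have hx := hg x
    rw [hd] at hx
    exact (abs_sub_le _ ((f : C(X, ℝ)) x) _).trans_lt (by linarith)

/-- Maximal ideals of `C_c(X)` are closed in the `m_c`-topology. -/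
theorem isClosed_mc_of_isMaximal {J : Ideal (Cc X)} (hJ : J.IsMaximal) :
    IsClosed[mcTopology X] (J : Set (Cc X)) := by
  let _ := mcTopology X
  refine isClosed_of_closure_subset fun f hf => ?_
  by_contra hfJ
  obtain ⟨a, m, hm, ham⟩ := hJ.exists_inv hfJ
  -- With this radius, `|g - f| < u` forces `|a * (g - f)| < 1`, so `a * g + m = 1 + a * (g - f)` is
  -- positive.
  let u : Cc X := ⟨⟨fun x => (1 + |(a : C(X, ℝ)) x|)⁻¹,
    (by fun_prop : Continuous fun x => 1 + |(a : C(X, ℝ)) x|).inv₀ fun x => by positivity⟩,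
    countable_range_of_comp₂ a.2 a.2 fun b _ => (1 + |b|)⁻¹⟩
  have hu (x : X) : (u : C(X, ℝ)) x = (1 + |(a : C(X, ℝ)) x|)⁻¹ := rfl
  obtain ⟨g, hgJ, hg⟩ := mem_closure_mc_iff.1 hf u
    (isPosUnit_of_pos u fun x => by rw [hu]; positivity)
  refine hJ.ne_top (J.eq_top_of_isUnit_mem (J.add_mem (J.mul_mem_left a hgJ) hm)
    (isPosUnit_of_pos _ fun x => ?_).1)
  have h1 : (a : C(X, ℝ)) x * (f : C(X, ℝ)) x + (m : C(X, ℝ)) x = 1 :=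
    congrArg (fun k : Cc X => (k : C(X, ℝ)) x) ham
  have h2 : |(a : C(X, ℝ)) x * ((g : C(X, ℝ)) x - (f : C(X, ℝ)) x)| < 1 := by
    have hx := hg x
    rw [hu, ← one_div, lt_div_iff₀' (by positivity)] at hx
    rw [abs_mul]
    exact (mul_le_mul_of_nonneg_right (by linarith) (abs_nonneg _)).trans_lt hx
  have h3 := (abs_lt.1 h2).1
  change 0 < (a : C(X, ℝ)) x * (g : C(X, ℝ)) x + (m : C(X, ℝ)) x
  linarith

/-- An idempotent in the Jacobson radical of an ideal lies in the ideal. -/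
theorem _root_.Ideal.mem_of_isIdempotentElem_of_mem_jacobson {R : Type*} [CommRing R]
    {I : Ideal R} {e : R} (he : IsIdempotentElem e) (h : e ∈ I.jacobson) : e ∈ I := by
  -- This gives `z * (1 - e) - 1 ∈ I`; multiplying by `-e` kills the `z` term and leaves `e`.
  obtain ⟨z, hz⟩ := Ideal.mem_jacobson_iff.1 h (-1)
  have := I.mul_mem_left (-e) hz
  convert this using 1
  linear_combination (-z) * he.eq

/-- For a positive unit `u`, any `f` in `C_c(X)` can be cut off to a multiple `f e` within `u` of
`f`, where the idempotent `e` is itself a multiple of `f`. -/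
theorem exists_isIdempotentElem_mul_mem_M (f : Cc X) {u : Cc X} (hu : IsPosUnit u) :
    ∃ h : Cc X, IsIdempotentElem (h * f) ∧ f * (h * f) ∈ M f u := by
  have hc : (Set.range fun x => |(f : C(X, ℝ)) x| / (u : C(X, ℝ)) x).Countable :=
    countable_range_of_comp₂ f.2 u.2 fun a b => |a| / b
  -- A countable range cannot fill the interval. At a missed level `r`, strict and weak inequality
  -- define the same set, which is therefore clopen.
  obtain ⟨r, ⟨hr0, hr1⟩, hr⟩ : ∃ r ∈ Set.Ioo (0 : ℝ) 1,
      r ∉ Set.range fun x => |(f : C(X, ℝ)) x| / (u : C(X, ℝ)) x := by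
    by_contra! hsub
    exact (Cardinal.Real.Ioo_countable_iff.1 (hc.mono hsub)).not_gt one_pos
  have hne (x : X) : |(f : C(X, ℝ)) x| ≠ r * (u : C(X, ℝ)) x := fun h =>
    hr ⟨x, (div_eq_iff (hu.2 x).ne').2 h⟩
  classical
  let A : Set X := {x | r * (u : C(X, ℝ)) x < |(f : C(X, ℝ)) x|}
  have hA : IsClopen A := by
    refine ⟨?_, isOpen_lt (by fun_prop) (by fun_prop)⟩
    have : A = {x | r * (u : C(X, ℝ)) x ≤ |(f : C(X, ℝ)) x|} := by
      ext x
      simp only [A, Set.mem_ofPred_eq]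
      exact ⟨le_of_lt, fun h => lt_of_le_of_ne h (hne x).symm⟩
    rw [this]
    exact isClosed_le (by fun_prop) (by fun_prop)
  have hfA {x : X} (hx : x ∈ A) : (f : C(X, ℝ)) x ≠ 0 :=
    abs_pos.1 ((mul_pos hr0 (hu.2 x)).trans hx)
  -- The inverse of `f` on `A`, extended by zero: `h * f` is then the indicator of `A`, and off `A`
  -- the error `|f|` is at most `r * u < u`.
  let F : ℝ → ℝ → ℝ := fun a b => if r * b < |a| then a⁻¹ else 0
  have hcont : Continuous fun x => F ((f : C(X, ℝ)) x) ((u : C(X, ℝ)) x) := by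
    refine continuous_iff_continuousAt.2 fun x => ?_
    by_cases hx : x ∈ A
    · refine ((f : C(X, ℝ)).continuous.continuousAt.inv₀ (hfA hx)).congr ?_
      filter_upwards [hA.isOpen.mem_nhds hx] with y hy
      exact (if_pos hy).symm
    · refine (continuousAt_const (y := (0 : ℝ))).congr ?_
      filter_upwards [hA.compl.isOpen.mem_nhds hx] with y hy
      exact (if_neg hy).symm
  let h : Cc X := ⟨⟨_, hcont⟩, countable_range_of_comp₂ f.2 u.2 F⟩
  have hin {x : X} (hx : x ∈ A) : (h : C(X, ℝ)) x * (f : C(X, ℝ)) x = 1 := by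
    rw [show (h : C(X, ℝ)) x = ((f : C(X, ℝ)) x)⁻¹ from if_pos hx, inv_mul_cancel₀ (hfA hx)]
  have hout {x : X} (hx : x ∉ A) : (h : C(X, ℝ)) x = 0 := if_neg hx
  refine ⟨h, ?_, fun x => ?_⟩
  · ext x
    change (h : C(X, ℝ)) x * (f : C(X, ℝ)) x * ((h : C(X, ℝ)) x * (f : C(X, ℝ)) x) =
      (h : C(X, ℝ)) x * (f : C(X, ℝ)) x
    by_cases hx : x ∈ A
    · simp [hin hx]
    · simp [hout hx]
  · change |(f : C(X, ℝ)) x * ((h : C(X, ℝ)) x * (f : C(X, ℝ)) x) - (f : C(X, ℝ)) x| <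
      (u : C(X, ℝ)) x
    by_cases hx : x ∈ A
    · simpa [hin hx] using hu.2 x
    · have h1 : |(f : C(X, ℝ)) x| ≤ r * (u : C(X, ℝ)) x := not_lt.1 hx
      simp only [hout hx, zero_mul, mul_zero, zero_sub, abs_neg]
      exact h1.trans_lt (mul_lt_of_lt_one_left (hu.2 x) hr1)

/-- The `m_c`-closure of an ideal of `C_c(X)` is its Jacobson radical. -/
theorem closure_mc_eq_jacobson (I : Ideal (Cc X)) :
    closure[mcTopology X] (I : Set (Cc X)) = I.jacobson := by
  let _ := mcTopology X
  refine Set.Subset.antisymm ?_ fun f hf => mem_closure_mc_iff.2 fun u hu => ?_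
  · intro f hf
    refine Ideal.mem_sInf.2 fun {J} hJ => ?_
    exact closure_minimal (fun _ h => hJ.1 h) (isClosed_mc_of_isMaximal hJ.2) hf
  · obtain ⟨h, he, hM⟩ := exists_isIdempotentElem_mul_mem_M f hu
    exact ⟨_, I.mul_mem_left f (Ideal.mem_of_isIdempotentElem_of_mem_jacobson he
      (I.jacobson.mul_mem_left h hf)), hM⟩

end Cc

theorem theorem3p8 {X : Type*} [TopologicalSpace X] [T2Space X]
    (hX : TopologicalSpace.IsTopologicalBasis {s : Set X | IsClopen s}) (I : Ideal (Cc X)) :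
    closure[Cc.mcTopology X] (I : Set (Cc X)) =
        (⋂ M ∈ {M : Ideal (Cc X) | M.IsMaximal ∧ I ≤ M}, (M : Set (Cc X))) ∧
      (IsClosed[Cc.mcTopology X] (I : Set (Cc X)) ↔
        I = sInf {M : Ideal (Cc X) | M.IsMaximal ∧ I ≤ M}) ∧
      (IsClosed[Cc.mcTopology X] (I : Set (Cc X)) ↔
        ∃ S : Set (Ideal (Cc X)), (∀ M ∈ S, M.IsMaximal) ∧ I = sInf S) := by
  let _ := Cc.mcTopology X
  have hjac : I.jacobson = sInf {M : Ideal (Cc X) | M.IsMaximal ∧ I ≤ M} := by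
    simp only [Ideal.jacobson, and_comm]
  have hclosure := Cc.closure_mc_eq_jacobson I
  rw [hjac] at hclosure
  have hclosed : IsClosed (I : Set (Cc X)) ↔
      I = sInf {M : Ideal (Cc X) | M.IsMaximal ∧ I ≤ M} := by
    rw [← closure_eq_iff_isClosed, hclosure, SetLike.coe_set_eq, eq_comm]
  refine ⟨by rw [hclosure, Submodule.coe_sInf], hclosed,
    fun h => ⟨_, fun _ hM => hM.1, hclosed.1 h⟩, ?_⟩
  rintro ⟨S, hS, rfl⟩
  rw [Submodule.coe_sInf]
  exact isClosed_biInter fun J hJ => Cc.isClosed_mc_of_isMaximal (hS J hJ)
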